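/- Let $(N,\tilde g)$ be a smooth Riemannian manifold with Levi-Civita connection $\tilde\nabla$, endowed with a concurrent vector field $v$, that is, a smooth vector field with $\tilde\nabla_X v = X$ for every vector field $X$ on $N$. Let $(M,g)$ be an immersed Riemannian submanifold of $(N,\tilde g)$ (with the induced metric) of dimension $n\ge 1$, and let $v^T$ denote the vector field on $M$ given by the tangential component of $v$ along $M$. Assume that $M$ is minimal, that is, its mean curvature vector $H=\frac1n\operatorname{trace} h$ vanishes identically, where $h$ is the second fundamental form. Let $\rho$ be a smooth function on $M$ such that $(M,g,v^T,\rho)$ is an almost Yamabe soliton: $v^T$ is a complete vector field on $M$ and $$(R-\rho)\,g=\tfrac12\,\mathcal L_{v^T}g,$$ where $R$ is the scalar curvature of $(M,g)$ and $\mathcal L$ is the Lie derivative. Then $R=\rho+1$ on all of $M$. -/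

import Mathlib

open Bundle Manifold ContDiff

noncomputable section

set_option linter.unusedSectionVars false

namespace YamabeSoliton

section RiemannianManifold

variable {E : Type*} [NormedAddCommGroup E] [NormedSpace ℝ E]
  {H : Type*} [TopologicalSpace H] (I : ModelWithCorners ℝ E H)
  {M : Type*} [TopologicalSpace M] [ChartedSpace H M]
  [RiemannianBundle (fun x : M ↦ TangentSpace I x)]

/-- The right-hand side of Koszul's formula for `2 g(∇_X Y, Z)` at the point `x`. -/
def koszul (X Y Z : Π x : M, TangentSpace I x) (x : M) : ℝ :=
  mvfderiv I (fun q ↦ inner ℝ (Y q) (Z q)) x (X x)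
    + mvfderiv I (fun q ↦ inner ℝ (X q) (Z q)) x (Y x)
    - mvfderiv I (fun q ↦ inner ℝ (X q) (Y q)) x (Z x)
    + inner ℝ (VectorField.mlieBracket I X Y x) (Z x)
    - inner ℝ (VectorField.mlieBracket I X Z x) (Y x)
    - inner ℝ (VectorField.mlieBracket I Y Z x) (X x)

variable [FiniteDimensional ℝ E] [IsManifold I ∞ M]
  [IsContMDiffRiemannianBundle I ∞ E (fun x : M ↦ TangentSpace I x)]

theorem mdifferentiableAt_inner {X Y : Π x : M, TangentSpace I x} {x : M}
    (hX : MDiffAt (T% X) x) (hY : MDiffAt (T% Y) x) :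
    MDiffAt (fun q ↦ (inner ℝ (X q) (Y q) : ℝ)) x :=
  MDifferentiableAt.inner_bundle (IB := I) (F := E) (E := fun x : M ↦ TangentSpace I x)
    (b := id) hX hY

theorem mvfderiv_inner_comm (X Y : Π x : M, TangentSpace I x) :
    mvfderiv I (fun q ↦ (inner ℝ (X q) (Y q) : ℝ)) =
      mvfderiv I (fun q ↦ (inner ℝ (Y q) (X q) : ℝ)) := by
  simp only [real_inner_comm]

theorem mvfderiv_inner_smul {f : M → ℝ} {X Y : Π x : M, TangentSpace I x} {x : M}
    (hf : MDiffAt f x) (hX : MDiffAt (T% X) x) (hY : MDiffAt (T% Y) x) (w : TangentSpace I x) :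
    mvfderiv I (fun q ↦ (inner ℝ ((f • X) q) (Y q) : ℝ)) x w =
      f x * mvfderiv I (fun q ↦ (inner ℝ (X q) (Y q) : ℝ)) x w
        + inner ℝ (X x) (Y x) * mvfderiv I f x w := by
  have h : (fun q ↦ (inner ℝ ((f • X) q) (Y q) : ℝ)) = fun q ↦ f q * inner ℝ (X q) (Y q) := by
    funext q
    exact real_inner_smul_left _ _ _
  rw [h, mvfderiv_fun_mul hf (mdifferentiableAt_inner I hX hY)]
  rfl

theorem mvfderiv_inner_add {X X' Y : Π x : M, TangentSpace I x} {x : M}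
    (hX : MDiffAt (T% X) x) (hX' : MDiffAt (T% X') x) (hY : MDiffAt (T% Y) x)
    (w : TangentSpace I x) :
    mvfderiv I (fun q ↦ (inner ℝ ((X + X') q) (Y q) : ℝ)) x w =
      mvfderiv I (fun q ↦ (inner ℝ (X q) (Y q) : ℝ)) x w
        + mvfderiv I (fun q ↦ (inner ℝ (X' q) (Y q) : ℝ)) x w := by
  have h : (fun q ↦ (inner ℝ ((X + X') q) (Y q) : ℝ)) =
      fun q ↦ inner ℝ (X q) (Y q) + inner ℝ (X' q) (Y q) := by
    funext q
    exact inner_add_left _ _ _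
  rw [h, mvfderiv_fun_add (mdifferentiableAt_inner I hX hY) (mdifferentiableAt_inner I hX' hY)]
  rfl

theorem koszul_tensorial_left (Y Z : Π x : M, TangentSpace I x) (x : M)
    (hY : MDiffAt (T% Y) x) (hZ : MDiffAt (T% Z) x) :
    TensorialAt I E (fun X ↦ koszul I X Y Z x) x where
  smul {f X} hf hX := by
    unfold koszul
    rw [mvfderiv_inner_smul I hf hX hZ, mvfderiv_inner_smul I hf hX hY,
      VectorField.mlieBracket_smul_left hf hX, VectorField.mlieBracket_smul_left hf hX]
    simp only [inner_add_left, real_inner_smul_left, Pi.smul_apply', map_smul, smul_eq_mul,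
      real_inner_smul_right, neg_smul, inner_neg_left]
    ring
  add {X X'} hX hX' := by
    unfold koszul
    rw [mvfderiv_inner_add I hX hX' hZ, mvfderiv_inner_add I hX hX' hY,
      VectorField.mlieBracket_add_left hX hX', VectorField.mlieBracket_add_left hX hX']
    simp only [inner_add_left, inner_add_right, Pi.add_apply, map_add]
    ring

theorem koszul_tensorial_right (X Y : Π x : M, TangentSpace I x) (x : M)
    (hX : MDiffAt (T% X) x) (hY : MDiffAt (T% Y) x) :
    TensorialAt I E (fun Z ↦ koszul I X Y Z x) x where
  smul {f Z} hf hZ := by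
    unfold koszul
    rw [mvfderiv_inner_comm I Y, mvfderiv_inner_comm I X (f • Z), mvfderiv_inner_comm I Y Z,
      mvfderiv_inner_comm I X Z,
      mvfderiv_inner_smul I hf hZ hX, mvfderiv_inner_smul I hf hZ hY,
      VectorField.mlieBracket_smul_right hf hZ, VectorField.mlieBracket_smul_right hf hZ]
    simp only [inner_add_left, real_inner_smul_left, Pi.smul_apply', map_smul, smul_eq_mul,
      real_inner_smul_right, real_inner_comm (Z x)]
    ring
  add {Z Z'} hZ hZ' := by
    unfold koszul
    rw [mvfderiv_inner_comm I Y, mvfderiv_inner_comm I X (Z + Z'), mvfderiv_inner_comm I Y Z,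
      mvfderiv_inner_comm I X Z, mvfderiv_inner_comm I Y Z', mvfderiv_inner_comm I X Z',
      mvfderiv_inner_add I hZ hZ' hX, mvfderiv_inner_add I hZ hZ' hY,
      VectorField.mlieBracket_add_right hZ hZ', VectorField.mlieBracket_add_right hZ hZ']
    simp only [inner_add_left, inner_add_right, Pi.add_apply, map_add]
    ring

theorem koszul_smul_middle {f : M → ℝ} {X Y Z : Π x : M, TangentSpace I x} {x : M}
    (hf : MDiffAt f x) (hX : MDiffAt (T% X) x) (hY : MDiffAt (T% Y) x) (hZ : MDiffAt (T% Z) x) :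
    koszul I X (f • Y) Z x =
      f x * koszul I X Y Z x + 2 * (mvfderiv I f x (X x) * inner ℝ (Y x) (Z x)) := by
  unfold koszul
  rw [mvfderiv_inner_comm I X (f • Y), mvfderiv_inner_comm I X Y,
    mvfderiv_inner_smul I hf hY hZ, mvfderiv_inner_smul I hf hY hX,
    VectorField.mlieBracket_smul_right hf hY, VectorField.mlieBracket_smul_left hf hY]
  simp only [inner_add_left, real_inner_smul_left, Pi.smul_apply', map_smul, smul_eq_mul,
    real_inner_smul_right, neg_smul, inner_neg_left]
  ring

theorem koszul_add_middle {X Y Y' Z : Π x : M, TangentSpace I x} {x : M}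
    (hX : MDiffAt (T% X) x) (hY : MDiffAt (T% Y) x) (hY' : MDiffAt (T% Y') x)
    (hZ : MDiffAt (T% Z) x) :
    koszul I X (Y + Y') Z x = koszul I X Y Z x + koszul I X Y' Z x := by
  unfold koszul
  rw [mvfderiv_inner_comm I X (Y + Y'), mvfderiv_inner_comm I X Y, mvfderiv_inner_comm I X Y',
    mvfderiv_inner_add I hY hY' hZ, mvfderiv_inner_add I hY hY' hX,
    VectorField.mlieBracket_add_right hY hY', VectorField.mlieBracket_add_left hY hY']
  simp only [inner_add_left, inner_add_right, Pi.add_apply, map_add]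
  ring

/-- `koszul I X Y Z x` as a bilinear form in `X x` and `Z x`. -/
def koszulForm (Y : Π x : M, TangentSpace I x) (x : M) (hY : MDiffAt (T% Y) x) :
    TangentSpace I x →L[ℝ] TangentSpace I x →L[ℝ] ℝ :=
  TensorialAt.mkHom₂ (I := I) (F := E) (F' := E) (fun X Z ↦ koszul I X Y Z x) x
    (fun Z hZ ↦ koszul_tensorial_left I Y Z x hY hZ)
    (fun X hX ↦ koszul_tensorial_right I X Y x hX hY)

instance finiteDimensional_tangentSpace (x : M) : FiniteDimensional ℝ (TangentSpace I x) :=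
  inferInstanceAs (FiniteDimensional ℝ E)

open Classical in
/-- `∇ Y`: for `Y` differentiable at `x`, the vector `∇_w Y` is the one determined by
`2 g(∇_w Y, z) = koszulForm I Y x w z` (expanded in an orthonormal basis of the tangent space). -/
def leviCivitaFun (Y : Π x : M, TangentSpace I x) (x : M) :
    TangentSpace I x →L[ℝ] TangentSpace I x :=
  if hY : MDiffAt (T% Y) x then
    ∑ i, ((1 / 2 : ℝ) • (koszulForm I Y x hY).flip
      (stdOrthonormalBasis ℝ (TangentSpace I x) i)).smulRight
        (stdOrthonormalBasis ℝ (TangentSpace I x) i)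
  else 0

/-- Koszul's formula. -/
theorem inner_leviCivitaFun {X Y Z : Π x : M, TangentSpace I x} {x : M}
    (hX : MDiffAt (T% X) x) (hY : MDiffAt (T% Y) x) (hZ : MDiffAt (T% Z) x) :
    inner ℝ (leviCivitaFun I Y x (X x)) (Z x) = (1 / 2 : ℝ) * koszul I X Y Z x := by
  have key : ∀ w z : TangentSpace I x,
      inner ℝ (leviCivitaFun I Y x w) z = (1 / 2 : ℝ) * koszulForm I Y x hY w z := by
    intro w z
    have hz := (stdOrthonormalBasis ℝ (TangentSpace I x)).sum_repr' z
    conv_rhs => rw [← hz]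
    simp [leviCivitaFun, hY, sum_inner, real_inner_smul_left, Finset.mul_sum]
    refine Finset.sum_congr rfl fun i _ ↦ ?_
    ring
  rw [key]
  congr 1
  exact TensorialAt.mkHom₂_apply (I := I) (F := E) (F' := E) (Φ := fun X Z ↦ koszul I X Y Z x)
    (fun Z hZ ↦ koszul_tensorial_left I Y Z x hY hZ)
    (fun X hX ↦ koszul_tensorial_right I X Y x hX hY) hX hZ

/-- The Levi-Civita connection: `leviCivita I Y x w` is `∇_w Y`. -/
def leviCivita : CovariantDerivative I E (fun x : M ↦ TangentSpace I x) where
  toFun := leviCivitaFun I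
  isCovariantDerivativeOnUniv :=
    { add := by
        intro Y Y' x hY hY' _
        have hYY : MDiffAt (T% (Y + Y')) x := mdifferentiableAt_add_section hY hY'
        ext w
        refine ext_inner_right ℝ fun z ↦ ?_
        have hw := FiberBundle.mdifferentiableAt_extend I E (V := fun x : M ↦ TangentSpace I x) w
        have hz := FiberBundle.mdifferentiableAt_extend I E (V := fun x : M ↦ TangentSpace I x) z
        have h1 := inner_leviCivitaFun I hw hYY hz
        have h2 := inner_leviCivitaFun I hw hY hz
        have h3 := inner_leviCivitaFun I hw hY' hz
        rw [koszul_add_middle I hw hY hY' hz] at h1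
        simp only [FiberBundle.extend_apply_self] at h1 h2 h3
        rw [add_apply, inner_add_left, h1, h2, h3]
        ring
      leibniz := by
        intro Y f x hY hf _
        have hfY : MDiffAt (T% (f • Y)) x := hf.smul_section hY
        ext w
        refine ext_inner_right ℝ fun z ↦ ?_
        have hw := FiberBundle.mdifferentiableAt_extend I E (V := fun x : M ↦ TangentSpace I x) w
        have hz := FiberBundle.mdifferentiableAt_extend I E (V := fun x : M ↦ TangentSpace I x) z
        have h1 := inner_leviCivitaFun I hw hfY hz
        have h2 := inner_leviCivitaFun I hw hY hz
        rw [koszul_smul_middle I hf hw hY hz] at h1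
        simp only [FiberBundle.extend_apply_self] at h1 h2
        rw [add_apply, smul_apply,
          ContinuousLinearMap.smulRight_apply, inner_add_left, real_inner_smul_left,
          real_inner_smul_left, h1, h2]
        ring }

/-- The Levi-Civita connection is compatible with the metric. -/
theorem leviCivita_metric {X Y Z : Π x : M, TangentSpace I x} {x : M}
    (hX : MDiffAt (T% X) x) (hY : MDiffAt (T% Y) x) (hZ : MDiffAt (T% Z) x) :
    mvfderiv I (fun q ↦ (inner ℝ (Y q) (Z q) : ℝ)) x (X x) =
      inner ℝ (leviCivita I Y x (X x)) (Z x) + inner ℝ (Y x) (leviCivita I Z x (X x)) := by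
  have h1 := inner_leviCivitaFun I hX hY hZ
  have h2 := inner_leviCivitaFun I hX hZ hY
  rw [real_inner_comm _ (Y x)]
  change _ = inner ℝ (leviCivitaFun I Y x (X x)) (Z x) + inner ℝ (leviCivitaFun I Z x (X x)) (Y x)
  rw [h1, h2]
  unfold koszul
  rw [mvfderiv_inner_comm I Z Y, VectorField.mlieBracket_swap_apply (V := Z) (W := Y),
    inner_neg_left]
  ring

/-- The Levi-Civita connection is torsion-free. -/
theorem leviCivita_torsion {X Y : Π x : M, TangentSpace I x} {x : M}
    (hX : MDiffAt (T% X) x) (hY : MDiffAt (T% Y) x) :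
    leviCivita I Y x (X x) - leviCivita I X x (Y x) = VectorField.mlieBracket I X Y x := by
  refine ext_inner_right ℝ fun z ↦ ?_
  have hz := FiberBundle.mdifferentiableAt_extend I E (V := fun x : M ↦ TangentSpace I x) z
  have h1 := inner_leviCivitaFun I hX hY hz
  have h2 := inner_leviCivitaFun I hY hX hz
  simp only [FiberBundle.extend_apply_self] at h1 h2
  rw [inner_sub_left]
  change inner ℝ (leviCivitaFun I Y x (X x)) z - inner ℝ (leviCivitaFun I X x (Y x)) z = _
  rw [h1, h2]
  unfold koszul
  rw [mvfderiv_inner_comm I Y X, VectorField.mlieBracket_swap_apply (V := Y) (W := X),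
    inner_neg_left]
  simp only [FiberBundle.extend_apply_self]
  ring

/-- The curvature `Rm(X, Y)Z = ∇_X ∇_Y Z - ∇_Y ∇_X Z - ∇_{[X, Y]} Z`. -/
def curvature (X Y Z : Π x : M, TangentSpace I x) (x : M) : TangentSpace I x :=
  leviCivita I (fun q ↦ leviCivita I Z q (Y q)) x (X x)
    - leviCivita I (fun q ↦ leviCivita I Z q (X q)) x (Y x)
    - leviCivita I Z x (VectorField.mlieBracket I X Y x)

/-- The scalar curvature `R = ∑ i j, g(Rm(e_i, e_j)e_j, e_i)`, where `e` is an orthonormal basis of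
the tangent space at `x`, extended to vector fields that are smooth near `x`. -/
def scalarCurvature (x : M) : ℝ :=
  let e := stdOrthonormalBasis ℝ (TangentSpace I x)
  ∑ i, ∑ j, inner ℝ (curvature I (FiberBundle.extend E (e i)) (FiberBundle.extend E (e j))
    (FiberBundle.extend E (e j)) x) (e i)

/-- The Lie derivative `(L_V g)(X, Y) = V(g(X, Y)) - g([V, X], Y) - g(X, [V, Y])`. -/
def lieDerivMetric (V X Y : Π x : M, TangentSpace I x) (x : M) : ℝ :=
  mvfderiv I (fun q ↦ (inner ℝ (X q) (Y q) : ℝ)) x (V x)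
    - inner ℝ (VectorField.mlieBracket I V X x) (Y x)
    - inner ℝ (X x) (VectorField.mlieBracket I V Y x)

/-- A vector field is complete if through every point there passes an integral curve defined on
all of `ℝ`. -/
def IsCompleteField (V : Π x : M, TangentSpace I x) : Prop :=
  ∀ x : M, ∃ γ : ℝ → M, γ 0 = x ∧ IsMIntegralCurve γ V

/-- `(M, g, V, ρ)` is an almost Yamabe soliton: `V` is a complete smooth vector field, `ρ` is a
smooth function, and `(R - ρ) g = (1 / 2) L_V g`. -/
structure IsAlmostYamabeSoliton (V : Π x : M, TangentSpace I x) (ρ : M → ℝ) : Prop where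
  smooth_field : CMDiff ∞ (T% V)
  complete : IsCompleteField I V
  smooth_fun : CMDiff ∞ ρ
  soliton : ∀ (x : M) (X Y : Π x : M, TangentSpace I x),
    CMDiffAt ∞ (T% X) x → CMDiffAt ∞ (T% Y) x →
    (scalarCurvature I x - ρ x) * inner ℝ (X x) (Y x) = 1 / 2 * lieDerivMetric I V X Y x

/-- A concurrent vector field: a smooth vector field `v` with `∇_w v = w` for every tangent
vector `w`. -/
structure IsConcurrent (v : Π x : M, TangentSpace I x) : Prop where
  smooth : CMDiff ∞ (T% v)
  concurrent : ∀ (x : M) (w : TangentSpace I x), leviCivita I v x w = w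

end RiemannianManifold

section Submanifold

variable {E : Type*} [NormedAddCommGroup E] [NormedSpace ℝ E] [FiniteDimensional ℝ E]
  {H : Type*} [TopologicalSpace H] (I : ModelWithCorners ℝ E H)
  {M : Type*} [TopologicalSpace M] [ChartedSpace H M] [IsManifold I ∞ M]
  [RiemannianBundle (fun x : M ↦ TangentSpace I x)]
  [IsContMDiffRiemannianBundle I ∞ E (fun x : M ↦ TangentSpace I x)]
  {F : Type*} [NormedAddCommGroup F] [NormedSpace ℝ F] [FiniteDimensional ℝ F]
  {G : Type*} [TopologicalSpace G] (J : ModelWithCorners ℝ F G)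
  {N : Type*} [TopologicalSpace N] [ChartedSpace G N] [IsManifold J ∞ N]
  [RiemannianBundle (fun x : N ↦ TangentSpace J x)]
  [IsContMDiffRiemannianBundle J ∞ F (fun x : N ↦ TangentSpace J x)]

/-- `f : M → N` exhibits `(M, g)` as an immersed Riemannian submanifold of `(N, g')`: it is smooth
and `g` is the pullback of `g'`. In particular all differentials of `f` are injective. -/
structure IsIsometricImmersion (f : M → N) : Prop where
  smooth : CMDiff ∞ f
  isometric : ∀ (p : M) (X Y : TangentSpace I p),
    inner ℝ (mfderiv I J f p X) (mfderiv I J f p Y) = inner ℝ X Y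

/-- The tangential component of `w ∈ T_{f p} N`, as a vector of `T_p M`: it is determined by
`g(tangentialPart w, X) = g'(w, df X)` for all `X ∈ T_p M`. -/
def tangentialPart (f : M → N) (p : M) (w : TangentSpace J (f p)) : TangentSpace I p :=
  LinearMap.adjoint (mfderiv I J f p).toLinearMap w

/-- The normal component of `w ∈ T_{f p} N`. -/
def normalPart (f : M → N) (p : M) (w : TangentSpace J (f p)) : TangentSpace J (f p) :=
  w - mfderiv I J f p (tangentialPart I J f p w)

/-- `tangentialPart` and `normalPart` decompose `w` orthogonally along `df (T_p M)`. -/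
theorem inner_normalPart {f : M → N} (hf : IsIsometricImmersion I J f) (p : M)
    (w : TangentSpace J (f p)) (X : TangentSpace I p) :
    inner ℝ (normalPart I J f p w) (mfderiv I J f p X) = 0 := by
  have h : inner ℝ (tangentialPart I J f p w) X = inner ℝ w (mfderiv I J f p X) :=
    LinearMap.adjoint_inner_left _ _ _
  rw [normalPart, inner_sub_left, hf.isometric, h, sub_self]

/-- The derivative `∇_X W` of a vector field `W` along the map `f : M → N`, for the connection
pulled back along `f` from the Levi-Civita connection of `N`. In the trivialization of `TN`
around `f p`, write `W = ∑ W^i E_i` with the constant frame `E_i`; then `∇_X W` is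
`∑ dW^i(X) E_i + ∑ W^i ∇_{df X} E_i`. -/
def covAlong (f : M → N) (W : Π q : M, TangentSpace J (f q)) (p : M) (X : TangentSpace I p) :
    TangentSpace J (f p) :=
  letI t := trivializationAt F (fun x : N ↦ TangentSpace J x) (f p)
  t.symm (f p) (mvfderiv I (fun q ↦ (t ⟨f q, W q⟩).2) p X)
    + leviCivita J (FiberBundle.extend F (W p)) (f p) (mfderiv I J f p X)

/-- The second fundamental form `h(X, Y)`, the normal component of the derivative in the direction
`X` of `df Y`, where the vector `Y` is extended to a vector field on `M` that is smooth
near `p`. -/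
def secondFundamentalForm (f : M → N) (p : M) (X Y : TangentSpace I p) : TangentSpace J (f p) :=
  normalPart I J f p
    (covAlong I J f (fun q ↦ mfderiv I J f q (FiberBundle.extend E Y q)) p X)

/-- The mean curvature vector `H = (1 / n) trace h`. -/
def meanCurvature (f : M → N) (p : M) : TangentSpace J (f p) :=
  (Module.finrank ℝ E : ℝ)⁻¹ • ∑ i, secondFundamentalForm I J f p
    (stdOrthonormalBasis ℝ (TangentSpace I p) i) (stdOrthonormalBasis ℝ (TangentSpace I p) i)

/-- A submanifold is minimal if its mean curvature vector vanishes. -/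
def IsMinimal (f : M → N) : Prop :=
  ∀ p : M, meanCurvature I J f p = 0

end Submanifold

end YamabeSoliton

end

noncomputable section

set_option linter.unusedSectionVars false

namespace YamabeSoliton

open Filter Topology

section Charts

variable {E : Type*} [NormedAddCommGroup E] [NormedSpace ℝ E] [FiniteDimensional ℝ E]
  {H : Type*} [TopologicalSpace H] {I : ModelWithCorners ℝ E H} [I.Boundaryless]
  {M : Type*} [TopologicalSpace M] [ChartedSpace H M] [IsManifold I ∞ M]

/-- The coordinate expression of a vector field in the preferred chart at `p`. -/
def chartField (I : ModelWithCorners ℝ E H) (Y : Π q : M, TangentSpace I q) (p : M) : E → E :=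
  VectorField.mpullbackWithin 𝓘(ℝ, E) I (extChartAt I p).symm Y (Set.range I)

theorem chartField_apply_self (Y : Π q : M, TangentSpace I q) (p : M) :
    chartField I Y p (extChartAt I p p) = Y p := by
  have : IsManifold I 1 M := .of_le (n := ∞) (by norm_cast)
  have h : (Y ((extChartAt I p).symm (extChartAt I p p)) : E) = Y p :=
    congrArg (fun q ↦ (Y q : E)) (extChartAt_to_inv p)
  exact (congrArg (fun u : E ↦ (mfderivWithin 𝓘(ℝ, E) I (extChartAt I p).symm (Set.range I)
    (extChartAt I p p)).inverse u) h).trans (mfderivWithin_extChartAt_symm_inverse_apply (Y p))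

theorem differentiableAt_chartField {Y : Π q : M, TangentSpace I q} {p : M}
    (hY : MDiffAt (T% Y) p) : DifferentiableAt ℝ (chartField I Y p) (extChartAt I p p) := by
  have : IsManifold I 2 M := .of_le (n := ∞) (by norm_cast)
  rw [← mdifferentiableWithinAt_univ] at hY
  have h : DifferentiableWithinAt ℝ (chartField I Y p) _ (extChartAt I p p) :=
    hY.differentiableWithinAt_mpullbackWithin_vectorField
  rwa [Set.preimage_univ, Set.univ_inter, I.range_eq_univ, differentiableWithinAt_univ] at h

theorem mlieBracket_eq_lieBracket_chartField (X Y : Π q : M, TangentSpace I q) (p : M) :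
    VectorField.mlieBracket I X Y p =
      VectorField.lieBracket ℝ (chartField I X p) (chartField I Y p) (extChartAt I p p) := by
  have : IsManifold I 1 M := .of_le (n := ∞) (by norm_cast)
  have hinv (u : E) : (ContinuousLinearMap.inverse (M₂ := E)
      (mfderiv I 𝓘(ℝ, E) (extChartAt I p) p) : E →L[ℝ] E) u = u := by
    rw [mfderiv_extChartAt_self]
    exact congrArg (fun A : E →L[ℝ] E ↦ A u) ContinuousLinearMap.inverse_id
  rw [← VectorField.mlieBracketWithin_univ, VectorField.mlieBracketWithin_apply]
  refine (hinv _).trans ?_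
  rw [Set.preimage_univ, Set.univ_inter]
  simp only [chartField, I.range_eq_univ]
  exact congrFun VectorField.lieBracketWithin_univ _

variable {F : Type*} [NormedAddCommGroup F] [NormedSpace ℝ F]

theorem mvfderiv_extChartAt_symm {φ : M → F} {p : M} {z : E}
    (hz : z ∈ (extChartAt I p).target) (hφ : MDiffAt φ ((extChartAt I p).symm z))
    (Y : Π q : M, TangentSpace I q) :
    mvfderiv I φ ((extChartAt I p).symm z) (Y ((extChartAt I p).symm z)) =
      fderiv ℝ (φ ∘ (extChartAt I p).symm) z (chartField I Y p z) := by
  have : IsManifold I 1 M := .of_le (n := ∞) (by norm_cast)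
  have hs : MDiffAt[Set.range I] (extChartAt I p).symm z :=
    mdifferentiableWithinAt_extChartAt_symm hz
  have hinv := isInvertible_mfderivWithin_extChartAt_symm (I := I) hz
  rw [← fderivWithin_univ, ← mfderivWithin_eq_fderivWithin, ← I.range_eq_univ,
    mfderiv_comp_mfderivWithin z hφ hs (by
      rw [I.range_eq_univ]; exact uniqueMDiffWithinAt_univ _)]
  exact congrArg (mvfderiv I φ ((extChartAt I p).symm z))
    (hinv.self_apply_inverse (Y ((extChartAt I p).symm z))).symm

theorem mvfderiv_mvfderiv_apply {φ : M → F} {p : M} (hφ : CMDiffAt 2 φ p)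
    {Y : Π q : M, TangentSpace I q} (hY : MDiffAt (T% Y) p) (w : TangentSpace I p) :
    mvfderiv I (fun q ↦ mvfderiv I φ q (Y q)) p w =
      fderiv ℝ (fderiv ℝ (φ ∘ (extChartAt I p).symm)) (extChartAt I p p) w (Y p)
        + fderiv ℝ (φ ∘ (extChartAt I p).symm) (extChartAt I p p)
            (fderiv ℝ (chartField I Y p) (extChartAt I p p) w) := by
  have : IsManifold I 1 M := .of_le (n := ∞) (by norm_cast)
  have : IsManifold I 2 M := .of_le (n := ∞) (by norm_cast)
  set e := extChartAt I p with he
  have hφe : ContDiffAt ℝ 2 (φ ∘ e.symm) (e p) := by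
    have := (contMDiffAt_iff.1 hφ).2
    rw [I.range_eq_univ, contDiffWithinAt_univ] at this
    exact this
  have hψ := ((hφe.fderiv_right (m := 1) (by norm_num)).differentiableAt
    one_ne_zero).hasFDerivAt.clm_apply
    (differentiableAt_chartField hY).hasFDerivAt
  have hev : ∀ᶠ q in 𝓝 p, MDiffAt φ q := by
    filter_upwards [contMDiffAt_iff_contMDiffAt_nhds (by simp) |>.1 hφ] with q hq
      using hq.mdifferentiableAt two_ne_zero
  have heq : (fun q ↦ mvfderiv I φ q (Y q)) =ᶠ[𝓝 p]
      (fun z ↦ fderiv ℝ (φ ∘ e.symm) z (chartField I Y p z)) ∘ e := by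
    filter_upwards [hev, extChartAt_source_mem_nhds (I := I) p] with q hq hqs
    have hz : e q ∈ e.target := e.map_source hqs
    have hq' : e.symm (e q) = q := e.left_inv hqs
    have := mvfderiv_extChartAt_symm hz (φ := φ) (by rw [← he, hq']; exact hq) Y
    rw [← he, hq'] at this
    exact this
  have hm := HasMFDerivAt.comp p hψ.hasMFDerivAt
    (mdifferentiableAt_extChartAt (I := I) (mem_chart_source H p)).hasMFDerivAt
  have h2 := (hm.congr_of_eventuallyEq heq).mfderiv
  have h3 : fderiv ℝ (fderiv ℝ (φ ∘ e.symm)) (e p) w (chartField I Y p (e p)) =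
      fderiv ℝ (fderiv ℝ (φ ∘ e.symm)) (e p) w (Y p) :=
    congrArg (fderiv ℝ (fderiv ℝ (φ ∘ e.symm)) (e p) w) (chartField_apply_self Y p)
  rw [mfderiv_extChartAt_self] at h2
  refine (congrArg (fun A : E →L[ℝ] F ↦ A w) h2).trans ?_
  rw [← h3, add_comm]
  rfl

theorem mvfderiv_mlieBracket {φ : M → F} {p : M} (hφ : CMDiffAt 2 φ p)
    {X Y : Π q : M, TangentSpace I q} (hX : MDiffAt (T% X) p) (hY : MDiffAt (T% Y) p) :
    mvfderiv I φ p (VectorField.mlieBracket I X Y p) =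
      mvfderiv I (fun q ↦ mvfderiv I φ q (Y q)) p (X p)
        - mvfderiv I (fun q ↦ mvfderiv I φ q (X q)) p (Y p) := by
  have hφe : ContDiffAt ℝ 2 (φ ∘ (extChartAt I p).symm) (extChartAt I p p) := by
    have := (contMDiffAt_iff.1 hφ).2
    rw [I.range_eq_univ, contDiffWithinAt_univ] at this
    exact this
  have hsymm := hφe.isSymmSndFDerivAt (by simp)
  have h1 := mvfderiv_extChartAt_symm (φ := φ) (mem_extChartAt_target (I := I) p)
    (by rw [extChartAt_to_inv]; exact hφ.mdifferentiableAt two_ne_zero)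
    (VectorField.mlieBracket I X Y)
  rw [chartField_apply_self, extChartAt_to_inv, mlieBracket_eq_lieBracket_chartField,
    VectorField.lieBracket, map_sub, chartField_apply_self, chartField_apply_self] at h1
  rw [mvfderiv_mvfderiv_apply hφ hY, mvfderiv_mvfderiv_apply hφ hX, hsymm.eq (X p) (Y p),
    mlieBracket_eq_lieBracket_chartField, VectorField.lieBracket,
    chartField_apply_self, chartField_apply_self, h1]
  abel

theorem chartField_extend {p : M} (w : TangentSpace I p) :
    chartField I (FiberBundle.extend E w) p =ᶠ[𝓝 (extChartAt I p p)]
      fun _ ↦ (trivializationAt E (TangentSpace I) p ⟨p, w⟩).2 := by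
  have : IsManifold I 1 M := .of_le (n := ∞) (by norm_cast)
  filter_upwards [extChartAt_target_mem_nhds (I := I) p] with z hz
  have hs : (extChartAt I p).symm z ∈ (chartAt H p).source := by
    rw [← extChartAt_source I]; exact (extChartAt I p).map_target hz
  have h := TangentBundle.symmL_trivializationAt (I := I) hs
  rw [(extChartAt I p).right_inv hz] at h
  have hinv := isInvertible_mfderivWithin_extChartAt_symm (I := I) hz
  have hb : (extChartAt I p).symm z ∈ (trivializationAt E (TangentSpace I) p).baseSet := by
    rwa [TangentBundle.trivializationAt_baseSet]
  have he : FiberBundle.extend E w ((extChartAt I p).symm z) =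
      (trivializationAt E (TangentSpace I) p).symmL ℝ ((extChartAt I p).symm z)
        (trivializationAt E (TangentSpace I) p ⟨p, w⟩).2 := by
    rw [Trivialization.symmL_apply _ hb]
    rfl
  refine (congrArg (mfderivWithin 𝓘(ℝ, E) I (extChartAt I p).symm (Set.range I) z).inverse <|
    he.trans (congrArg (fun A : E →L[ℝ] E ↦ A (trivializationAt E (TangentSpace I) p ⟨p, w⟩).2)
      h)).trans ?_
  exact hinv.inverse_apply_self (show E from (trivializationAt E (TangentSpace I) p ⟨p, w⟩).2)

theorem mlieBracket_extend {p : M} (w w' : TangentSpace I p) :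
    VectorField.mlieBracket I (FiberBundle.extend E w) (FiberBundle.extend E w') p = 0 := by
  rw [mlieBracket_eq_lieBracket_chartField, VectorField.lieBracket,
    (chartField_extend w).fderiv_eq, (chartField_extend w').fderiv_eq]
  simp
  rfl

end Charts

section Frame

variable {F : Type*} [NormedAddCommGroup F] [NormedSpace ℝ F] [FiniteDimensional ℝ F]
  {G : Type*} [TopologicalSpace G] (J : ModelWithCorners ℝ F G)
  {N : Type*} [TopologicalSpace N] [ChartedSpace G N] [IsManifold J ∞ N]

/-- The coordinate frame of the tangent bundle around `x`. -/
def coordFrame (x : N) (i : Fin (Module.finrank ℝ F)) : Π y : N, TangentSpace J y :=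
  (trivializationAt F (fun y : N ↦ TangentSpace J y) x).localFrame (Module.finBasis ℝ F) i

/-- The coefficients of a tangent vector in the coordinate frame around `x`. -/
def frameCoeff (x : N) (i : Fin (Module.finrank ℝ F)) (z : TangentBundle J N) : ℝ :=
  (Module.finBasis ℝ F).repr ((trivializationAt F (fun y : N ↦ TangentSpace J y) x) z).2 i

variable {J}

theorem mdifferentiableAt_coordFrame (x : N) (i : Fin (Module.finrank ℝ F)) :
    MDiffAt (T% (coordFrame J x i)) x :=
  (contMDiffAt_localFrame_of_mem 1 _ _ i
    (FiberBundle.mem_baseSet_trivializationAt' x)).mdifferentiableAt one_ne_zero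

theorem sum_repr_smul_coordFrame {x y : N}
    (hy : y ∈ (trivializationAt F (fun y : N ↦ TangentSpace J y) x).baseSet) (u : F) :
    ∑ i, (Module.finBasis ℝ F).repr u i • coordFrame J x i y =
      (trivializationAt F (fun y : N ↦ TangentSpace J y) x).symm y u := by
  set t := trivializationAt F (fun y : N ↦ TangentSpace J y) x
  have h : ∀ i, coordFrame J x i y = (t.linearEquivAt ℝ y hy).symm (Module.finBasis ℝ F i) := by
    intro i
    rw [coordFrame, Trivialization.localFrame_apply_of_mem_baseSet _ _ hy]
    simp [Trivialization.basisAt, t]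
  simp only [h]
  have hu := congrArg (t.linearEquivAt ℝ y hy).symm ((Module.finBasis ℝ F).sum_repr u)
  simp only [map_sum, map_smul] at hu
  rw [hu]
  rfl

theorem sum_frameCoeff_smul_coordFrame {x y : N}
    (hy : y ∈ (trivializationAt F (fun y : N ↦ TangentSpace J y) x).baseSet)
    (w : TangentSpace J y) :
    ∑ i, frameCoeff J x i ⟨y, w⟩ • coordFrame J x i y = w := by
  simp only [frameCoeff]
  rw [sum_repr_smul_coordFrame hy, Trivialization.symm_apply_apply_mk _ hy]

theorem mvfderiv_clm_comp {E' F' G' : Type*} [NormedAddCommGroup F'] [NormedSpace ℝ F']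
    [NormedAddCommGroup G'] [NormedSpace ℝ G']
    [NormedAddCommGroup E'] [NormedSpace ℝ E']
    {H : Type*} [TopologicalSpace H] {I : ModelWithCorners ℝ E' H}
    {M : Type*} [TopologicalSpace M] [ChartedSpace H M]
    {φ : M → F'} {p : M} (hφ : MDiffAt φ p) (A : F' →L[ℝ] G') (w : TangentSpace I p) :
    MDiffAt (fun q ↦ A (φ q)) p ∧ mvfderiv I (fun q ↦ A (φ q)) p w = A (mvfderiv I φ p w) := by
  have h := HasMFDerivAt.comp p (A.hasMFDerivAt (x := φ p)) hφ.hasMFDerivAt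
  exact ⟨h.mdifferentiableAt, congrArg (fun B : E' →L[ℝ] G' ↦ B w) h.mfderiv⟩

section Along

variable {E : Type*} [NormedAddCommGroup E] [NormedSpace ℝ E]
  {H : Type*} [TopologicalSpace H] {I : ModelWithCorners ℝ E H}
  {M : Type*} [TopologicalSpace M] [ChartedSpace H M]

theorem frameCoeff_along {f : M → N} {W : Π q : M, TangentSpace J (f q)} {p : M}
    (hW : MDifferentiableAt I J.tangent (fun q ↦ (⟨f q, W q⟩ : TangentBundle J N)) p)
    (i : Fin (Module.finrank ℝ F)) (X : TangentSpace I p) :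
    MDiffAt (fun q ↦ frameCoeff J (f p) i ⟨f q, W q⟩) p ∧
    mvfderiv I (fun q ↦ frameCoeff J (f p) i ⟨f q, W q⟩) p X =
      (Module.finBasis ℝ F).repr (mvfderiv I
        (fun q ↦ (trivializationAt F (fun y : N ↦ TangentSpace J y) (f p) ⟨f q, W q⟩).2) p X) i :=
  mvfderiv_clm_comp ((mdifferentiableAt_totalSpace J _).1 hW).2
    (LinearMap.toContinuousLinearMap ((Module.finBasis ℝ F).coord i)) X

theorem eventually_eq_sum_frameCoeff {f : M → N} (W : Π q : M, TangentSpace J (f q)) {p : M}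
    (hf : ContinuousAt f p) :
    ∀ᶠ q in 𝓝 p, W q = ∑ i, frameCoeff J (f p) i ⟨f q, W q⟩ • coordFrame J (f p) i (f q) := by
  have hb := (trivializationAt F (fun y : N ↦ TangentSpace J y) (f p)).open_baseSet.mem_nhds
    (FiberBundle.mem_baseSet_trivializationAt' (f p))
  filter_upwards [hf hb] with q hq
  exact (sum_frameCoeff_smul_coordFrame hq _).symm

end Along

variable [RiemannianBundle (fun x : N ↦ TangentSpace J x)]
  [IsContMDiffRiemannianBundle J ∞ F (fun x : N ↦ TangentSpace J x)]

theorem leviCivita_sum {ι : Type*} (s : Finset ι) {V : ι → Π y : N, TangentSpace J y} {x : N}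
    (hV : ∀ i, MDiffAt (T% (V i)) x) :
    leviCivita J (∑ i ∈ s, V i) x = ∑ i ∈ s, leviCivita J (V i) x := by
  classical
  induction s using Finset.induction_on with
  | empty => simp [CovariantDerivative.zero]
  | insert a s ha ih =>
    have hs : MDiffAt (T% (∑ i ∈ s, V i)) x := by
      have := MDifferentiableAt.sum_section (I := J) (s := s) (t := V) fun i _ ↦ hV i
      simpa [Finset.sum_apply] using this
    rw [Finset.sum_insert ha, Finset.sum_insert ha,
      (leviCivita J).isCovariantDerivativeOnUniv.add (hV a) hs, ih]

theorem leviCivita_eq_sum_coordFrame {V : Π y : N, TangentSpace J y} {x : N}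
    (hV : MDiffAt (T% V) x) (w : TangentSpace J x) :
    leviCivita J V x w =
      ∑ i, (mvfderiv J (fun y ↦ frameCoeff J x i ⟨y, V y⟩) x w • coordFrame J x i x
        + frameCoeff J x i ⟨x, V x⟩ • leviCivita J (coordFrame J x i) x w) := by
  have hc i := (frameCoeff_along (f := id) hV i w).1
  have hm i : MDiffAt (T% ((fun y ↦ frameCoeff J x i ⟨y, V y⟩) • coordFrame J x i)) x :=
    (hc i).smul_section (mdifferentiableAt_coordFrame x i)
  have hsum : MDiffAt (T% (∑ i, (fun y ↦ frameCoeff J x i ⟨y, V y⟩) • coordFrame J x i)) x := by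
    have := MDifferentiableAt.sum_section (I := J) (s := Finset.univ)
      (t := fun i ↦ (fun y ↦ frameCoeff J x i ⟨y, V y⟩) • coordFrame J x i) fun i _ ↦ hm i
    simpa [Finset.sum_apply] using this
  have heq : ∀ᶠ y in 𝓝 x,
      V y = (∑ i, (fun y ↦ frameCoeff J x i ⟨y, V y⟩) • coordFrame J x i) y := by
    filter_upwards [eventually_eq_sum_frameCoeff (f := id) V continuousAt_id] with y hy
    rw [Finset.sum_apply]
    exact hy
  have h := (leviCivita J).isCovariantDerivativeOnUniv.congr_of_eventuallyEq hV hsum univ_mem heq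
  change leviCivita J V x = leviCivita J _ x at h
  rw [h, leviCivita_sum _ hm, _root_.sum_apply]
  refine Finset.sum_congr rfl fun i _ ↦ ?_
  have hl := (leviCivita J).isCovariantDerivativeOnUniv.leibniz
    (mdifferentiableAt_coordFrame (J := J) x i) (hc i)
  change leviCivita J _ x = _ at hl
  refine (congrArg (fun A ↦ A w) hl).trans ?_
  rw [add_comm]
  rfl

variable {E : Type*} [NormedAddCommGroup E] [NormedSpace ℝ E]
  {H : Type*} [TopologicalSpace H] {I : ModelWithCorners ℝ E H}
  {M : Type*} [TopologicalSpace M] [ChartedSpace H M]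

theorem leviCivita_extend_eq_sum_coordFrame {x : N} (v w : TangentSpace J x) :
    leviCivita J (FiberBundle.extend F v) x w =
      ∑ i, frameCoeff J x i ⟨x, v⟩ • leviCivita J (coordFrame J x i) x w := by
  have hv := FiberBundle.mdifferentiableAt_extend J F (V := fun x : N ↦ TangentSpace J x) v
  rw [leviCivita_eq_sum_coordFrame hv]
  refine Finset.sum_congr rfl fun i _ ↦ ?_
  have hconst : (fun y ↦ frameCoeff J x i ⟨y, FiberBundle.extend F v y⟩) =ᶠ[𝓝 x]
      fun _ ↦ frameCoeff J x i ⟨x, v⟩ := by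
    have hb := (trivializationAt F (fun y : N ↦ TangentSpace J y) x).open_baseSet.mem_nhds
      (FiberBundle.mem_baseSet_trivializationAt' x)
    filter_upwards [hb] with y hy
    have h := Trivialization.apply_mk_symm _ hy
      (trivializationAt F (fun y : N ↦ TangentSpace J y) x ⟨x, v⟩).2
    have h' := congrArg (fun z : N × F ↦ (Module.finBasis ℝ F).repr z.2 i) h
    exact h'
  have hz : mvfderiv J (fun y ↦ frameCoeff J x i ⟨y, FiberBundle.extend F v y⟩) x w = 0 := by
    have := hconst.mfderiv_eq (I := J) (I' := 𝓘(ℝ, ℝ))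
    unfold mvfderiv
    rw [this, mfderiv_const]
    rfl
  rw [hz, zero_smul, zero_add, FiberBundle.extend_apply_self]

theorem covAlong_eq_sum_coordFrame [FiniteDimensional ℝ E] [IsManifold I ∞ M] {f : M → N}
    {W : Π q : M, TangentSpace J (f q)} {p : M}
    (hW : MDifferentiableAt I J.tangent (fun q ↦ (⟨f q, W q⟩ : TangentBundle J N)) p)
    (X : TangentSpace I p) :
    covAlong I J f W p X =
      ∑ i, (mvfderiv I (fun q ↦ frameCoeff J (f p) i ⟨f q, W q⟩) p X • coordFrame J (f p) i (f p)
        + frameCoeff J (f p) i ⟨f p, W p⟩ •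
          leviCivita J (coordFrame J (f p) i) (f p) (mfderiv I J f p X)) := by
  rw [Finset.sum_add_distrib, ← leviCivita_extend_eq_sum_coordFrame, covAlong]
  congr 1
  simp only [(frameCoeff_along hW _ X).2]
  exact (sum_repr_smul_coordFrame (FiberBundle.mem_baseSet_trivializationAt' (f p)) _).symm

theorem covAlong_comp [FiniteDimensional ℝ E] [IsManifold I ∞ M] {f : M → N} {p : M}
    (hf : MDiffAt f p) {V : Π y : N, TangentSpace J y} (hV : MDiffAt (T% V) (f p))
    (X : TangentSpace I p) :
    covAlong I J f (fun q ↦ V (f q)) p X = leviCivita J V (f p) (mfderiv I J f p X) := by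
  rw [covAlong_eq_sum_coordFrame (hV.comp p hf), leviCivita_eq_sum_coordFrame hV]
  refine Finset.sum_congr rfl fun i _ ↦ ?_
  congr 2
  exact mvfderiv_comp_apply (g := fun y ↦ frameCoeff J (f p) i ⟨y, V y⟩) p
    (frameCoeff_along (f := id) hV i (mfderiv I J f p X)).1 hf X

end Frame

section AlongMap

variable {E : Type*} [NormedAddCommGroup E] [NormedSpace ℝ E] [FiniteDimensional ℝ E]
  {H : Type*} [TopologicalSpace H] {I : ModelWithCorners ℝ E H}
  {M : Type*} [TopologicalSpace M] [ChartedSpace H M] [IsManifold I ∞ M]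
  {F : Type*} [NormedAddCommGroup F] [NormedSpace ℝ F] [FiniteDimensional ℝ F]
  {G : Type*} [TopologicalSpace G] {J : ModelWithCorners ℝ F G}
  {N : Type*} [TopologicalSpace N] [ChartedSpace G N] [IsManifold J ∞ N]
  [RiemannianBundle (fun x : N ↦ TangentSpace J x)]
  [IsContMDiffRiemannianBundle J ∞ F (fun x : N ↦ TangentSpace J x)]

theorem leviCivita_metric_apply {Y Z : Π x : N, TangentSpace J x} {x : N}
    (hY : MDiffAt (T% Y) x) (hZ : MDiffAt (T% Z) x) (w : TangentSpace J x) :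
    mvfderiv J (fun q ↦ (inner ℝ (Y q) (Z q) : ℝ)) x w =
      inner ℝ (leviCivita J Y x w) (Z x) + inner ℝ (Y x) (leviCivita J Z x w) := by
  have hw := FiberBundle.mdifferentiableAt_extend J F (V := fun x : N ↦ TangentSpace J x) w
  simpa using leviCivita_metric J hw hY hZ

theorem mvfderiv_sum_apply {ι : Type} (s : Finset ι) {φ : ι → M → ℝ} {p : M}
    (hφ : ∀ i, MDiffAt (φ i) p) (X : TangentSpace I p) :
    MDiffAt (∑ i ∈ s, φ i) p ∧
      mvfderiv I (∑ i ∈ s, φ i) p X = ∑ i ∈ s, mvfderiv I (φ i) p X := by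
  have h := HasMFDerivAt.sum (t := s) (f' := fun i ↦ mvfderiv I (φ i) p)
    fun i _ ↦ (hφ i).hasMFDerivAt
  exact ⟨h.mdifferentiableAt, (congrArg (fun A : E →L[ℝ] ℝ ↦ A X) h.mfderiv).trans
    (_root_.sum_apply s (fun i ↦ mvfderiv I (φ i) p) X)⟩

/-- The connection pulled back along `f` is compatible with the metric. -/
theorem mvfderiv_inner_along {f : M → N} {p : M} (hf : MDiffAt f p)
    {W W' : Π q : M, TangentSpace J (f q)}
    (hW : MDifferentiableAt I J.tangent (fun q ↦ (⟨f q, W q⟩ : TangentBundle J N)) p)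
    (hW' : MDifferentiableAt I J.tangent (fun q ↦ (⟨f q, W' q⟩ : TangentBundle J N)) p)
    (X : TangentSpace I p) :
    mvfderiv I (fun q ↦ (inner ℝ (W q) (W' q) : ℝ)) p X =
      inner ℝ (covAlong I J f W p X) (W' p) + inner ℝ (W p) (covAlong I J f W' p X) := by
  set c := fun i q ↦ frameCoeff J (f p) i ⟨f q, W q⟩ with hc
  set c' := fun i q ↦ frameCoeff J (f p) i ⟨f q, W' q⟩ with hc'
  set e := coordFrame J (f p) with he
  have hcd i := (frameCoeff_along hW i X).1
  have hcd' i := (frameCoeff_along hW' i X).1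
  have hg i j : MDiffAt (fun y ↦ (inner ℝ (e i y) (e j y) : ℝ)) (f p) :=
    mdifferentiableAt_inner J (mdifferentiableAt_coordFrame _ i) (mdifferentiableAt_coordFrame _ j)
  have hgf i j : MDiffAt ((fun y ↦ (inner ℝ (e i y) (e j y) : ℝ)) ∘ f) p := (hg i j).comp p hf
  have hterm i j := ((hcd i).mul (hcd' j)).mul (hgf i j)
  have hev : (fun q ↦ (inner ℝ (W q) (W' q) : ℝ)) =ᶠ[𝓝 p]
      ∑ i, ∑ j, (c i * c' j) * ((fun y ↦ (inner ℝ (e i y) (e j y) : ℝ)) ∘ f) := by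
    filter_upwards [eventually_eq_sum_frameCoeff W hf.continuousAt,
      eventually_eq_sum_frameCoeff W' hf.continuousAt] with q hq hq'
    rw [hq, hq']
    simp only [sum_inner, inner_sum, real_inner_smul_left, real_inner_smul_right,
      Finset.sum_apply, Pi.mul_apply, Function.comp_apply]
    rw [Finset.sum_comm]
    refine Finset.sum_congr rfl fun i _ ↦ Finset.sum_congr rfl fun j _ ↦ ?_
    simp only [hc, hc', he]
    ring
  have hder : mvfderiv I (fun q ↦ (inner ℝ (W q) (W' q) : ℝ)) p X = _ :=
    (congrArg (fun A : E →L[ℝ] ℝ ↦ A X) hev.mfderiv_eq).trans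
      (mvfderiv_sum_apply Finset.univ
        (fun i ↦ (mvfderiv_sum_apply Finset.univ (hterm i) X).1) X).2
  have hmet i j := leviCivita_metric_apply (mdifferentiableAt_coordFrame (J := J) (f p) i)
    (mdifferentiableAt_coordFrame (f p) j) (mfderiv I J f p X)
  have key : mvfderiv I (fun q ↦ (inner ℝ (W q) (W' q) : ℝ)) p X =
      ∑ i, ∑ j, (c i p * c' j p *
        (inner ℝ (leviCivita J (e i) (f p) (mfderiv I J f p X)) (e j (f p))
        + inner ℝ (e i (f p)) (leviCivita J (e j) (f p) (mfderiv I J f p X)))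
        + inner ℝ (e i (f p)) (e j (f p)) *
          (c i p * mvfderiv I (c' j) p X + c' j p * mvfderiv I (c i) p X)) := by
    refine hder.trans (Finset.sum_congr rfl fun i _ ↦ ?_)
    refine (mvfderiv_sum_apply Finset.univ (hterm i) X).2.trans
      (Finset.sum_congr rfl fun j _ ↦ ?_)
    rw [mvfderiv_mul ((hcd i).mul (hcd' j)) (hgf i j), mvfderiv_mul (hcd i) (hcd' j)]
    simp only [he, ← hmet]
    have hcomp := mvfderiv_comp_apply p (hg i j) hf X
    simp only [add_apply, smul_apply, smul_eq_mul, Pi.mul_apply, Function.comp_apply]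
    rw [← hcomp]
  have hcov : covAlong I J f W p X = ∑ i, (mvfderiv I (c i) p X • e i (f p)
      + c i p • leviCivita J (e i) (f p) (mfderiv I J f p X)) := covAlong_eq_sum_coordFrame hW X
  have hcov' : covAlong I J f W' p X = ∑ i, (mvfderiv I (c' i) p X • e i (f p)
      + c' i p • leviCivita J (e i) (f p) (mfderiv I J f p X)) := covAlong_eq_sum_coordFrame hW' X
  have hWp : W p = ∑ i, c i p • e i (f p) :=
    (eventually_eq_sum_frameCoeff W hf.continuousAt).self_of_nhds
  have hWp' : W' p = ∑ i, c' i p • e i (f p) :=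
    (eventually_eq_sum_frameCoeff W' hf.continuousAt).self_of_nhds
  rw [key, hcov, hcov', hWp, hWp']
  simp only [sum_inner]
  rw [← Finset.sum_add_distrib]
  refine Finset.sum_congr rfl fun i _ ↦ ?_
  simp only [inner_sum]
  rw [← Finset.sum_add_distrib]
  refine Finset.sum_congr rfl fun j _ ↦ ?_
  simp only [real_inner_smul_left, real_inner_smul_right, inner_add_left, inner_add_right]
  ring

variable [I.Boundaryless] [J.Boundaryless]

theorem leviCivita_extend_comm {x : N} (v w : TangentSpace J x) :
    leviCivita J (FiberBundle.extend F v) x w = leviCivita J (FiberBundle.extend F w) x v := by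
  have h := leviCivita_torsion J
    (FiberBundle.mdifferentiableAt_extend J F (V := fun x : N ↦ TangentSpace J x) w)
    (FiberBundle.mdifferentiableAt_extend J F (V := fun x : N ↦ TangentSpace J x) v)
  rw [mlieBracket_extend, FiberBundle.extend_apply_self, FiberBundle.extend_apply_self] at h
  exact sub_eq_zero.1 h

theorem mdifferentiableAt_mfderiv_apply {f : M → N} (hf : CMDiff ∞ f) {p : M}
    {Y : Π q : M, TangentSpace I q} (hY : MDiffAt (T% Y) p) :
    MDifferentiableAt I J.tangent
      (fun q ↦ (⟨f q, mfderiv I J f q (Y q)⟩ : TangentBundle J N)) p := by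
  have : IsManifold I 1 M := .of_le (n := ∞) (by norm_cast)
  have : IsManifold J 1 N := .of_le (n := ∞) (by norm_cast)
  have h := (hf.contMDiff_tangentMap (m := 1) (by norm_cast)).mdifferentiable one_ne_zero
  exact (h (⟨p, Y p⟩ : TangentBundle I M)).comp p hY

theorem trivializationAt_mfderiv_apply {f : M → N} (hf : CMDiff ∞ f) (p : M)
    (Y : Π q : M, TangentSpace I q) :
    (fun q ↦ (trivializationAt F (fun y : N ↦ TangentSpace J y) (f p)
      ⟨f q, mfderiv I J f q (Y q)⟩).2) =ᶠ[𝓝 p]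
      fun q ↦ mvfderiv I (extChartAt J (f p) ∘ f) q (Y q) := by
  have : IsManifold J 1 N := .of_le (n := ∞) (by norm_cast)
  filter_upwards [hf.continuous.continuousAt ((chartAt G (f p)).open_source.mem_nhds
    (mem_chart_source G (f p)))] with q hq
  have hq' : f q ∈ (chartAt G (f p)).source := hq
  have h := TangentBundle.continuousLinearMapAt_trivializationAt (I := J) hq'
  have hb : f q ∈ (trivializationAt F (fun y : N ↦ TangentSpace J y) (f p)).baseSet := by
    rwa [TangentBundle.trivializationAt_baseSet]
  have h1 : (trivializationAt F (fun y : N ↦ TangentSpace J y) (f p)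
      ⟨f q, mfderiv I J f q (Y q)⟩).2 = (trivializationAt F (fun y : N ↦ TangentSpace J y)
        (f p)).continuousLinearMapAt ℝ (f q) (mfderiv I J f q (Y q)) := by
    rw [Trivialization.continuousLinearMapAt_apply, Trivialization.coe_linearMapAt_of_mem _ hb]
  have h2 : mfderiv I 𝓘(ℝ, F) (extChartAt J (f p) ∘ f) q = _ :=
    mfderiv_comp q (mdifferentiableAt_extChartAt hq') (hf.mdifferentiable (by simp) q)
  refine h1.trans ?_
  rw [h]
  exact (congrArg (fun A : E →L[ℝ] F ↦ A (Y q)) h2).symm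

/-- The connection pulled back along `f` is torsion-free. -/
theorem covAlong_mfderiv_sub {f : M → N} (hf : CMDiff ∞ f) {p : M}
    {X Y : Π q : M, TangentSpace I q} (hX : MDiffAt (T% X) p) (hY : MDiffAt (T% Y) p) :
    covAlong I J f (fun q ↦ mfderiv I J f q (Y q)) p (X p)
      - covAlong I J f (fun q ↦ mfderiv I J f q (X q)) p (Y p) =
      mfderiv I J f p (VectorField.mlieBracket I X Y p) := by
  have : IsManifold J 2 N := .of_le (n := ∞) (by norm_cast)
  have hb := FiberBundle.mem_baseSet_trivializationAt' (F := F)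
    (E := fun y : N ↦ TangentSpace J y) (f p)
  set t := trivializationAt F (fun y : N ↦ TangentSpace J y) (f p) with ht
  have hφ : CMDiffAt 2 (extChartAt J (f p) ∘ f) p :=
    contMDiffAt_extChartAt.comp p ((hf p).of_le (by norm_cast))
  have hd (Z : Π q : M, TangentSpace I q) (w : TangentSpace I p) :
      mvfderiv I (fun q ↦ (t ⟨f q, mfderiv I J f q (Z q)⟩).2) p w =
        mvfderiv I (fun q ↦ mvfderiv I (extChartAt J (f p) ∘ f) q (Z q)) p w :=
    congrArg (fun A : E →L[ℝ] F ↦ A w) (trivializationAt_mfderiv_apply hf p Z).mfderiv_eq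
  have hbr := mvfderiv_mlieBracket hφ hX hY
  have hfp := (trivializationAt_mfderiv_apply (J := J) hf p
    (VectorField.mlieBracket I X Y)).self_of_nhds
  dsimp only at hfp
  rw [← ht, hbr, ← hd, ← hd] at hfp
  unfold covAlong
  rw [leviCivita_extend_comm (mfderiv I J f p (Y p)) (mfderiv I J f p (X p)),
    add_sub_add_right_eq_sub]
  have hs := congrArg (t.symmL ℝ (f p)) hfp
  rw [map_sub, t.symmL_apply hb, t.symmL_apply hb, t.symmL_apply hb,
    t.symm_apply_apply_mk hb] at hs
  exact hs.symm

end AlongMap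

section Soliton

variable {E : Type*} [NormedAddCommGroup E] [NormedSpace ℝ E] [FiniteDimensional ℝ E]
  {H : Type*} [TopologicalSpace H] {I : ModelWithCorners ℝ E H} [I.Boundaryless]
  {M : Type*} [TopologicalSpace M] [ChartedSpace H M] [IsManifold I ∞ M]
  [RiemannianBundle (fun x : M ↦ TangentSpace I x)]
  [IsContMDiffRiemannianBundle I ∞ E (fun x : M ↦ TangentSpace I x)]
  {F : Type*} [NormedAddCommGroup F] [NormedSpace ℝ F] [FiniteDimensional ℝ F]
  {G : Type*} [TopologicalSpace G] {J : ModelWithCorners ℝ F G} [J.Boundaryless]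
  {N : Type*} [TopologicalSpace N] [ChartedSpace G N] [IsManifold J ∞ N]
  [RiemannianBundle (fun x : N ↦ TangentSpace J x)]
  [IsContMDiffRiemannianBundle J ∞ F (fun x : N ↦ TangentSpace J x)]

theorem inner_tangentialPart (f : M → N) (p : M) (w : TangentSpace J (f p))
    (X : TangentSpace I p) :
    inner ℝ (tangentialPart I J f p w) X = inner ℝ w (mfderiv I J f p X) :=
  LinearMap.adjoint_inner_left _ _ _

theorem inner_normalPart_normalPart {f : M → N} (hf : IsIsometricImmersion I J f) (p : M)
    (w z : TangentSpace J (f p)) :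
    inner ℝ (normalPart I J f p w) (normalPart I J f p z) =
      inner ℝ (normalPart I J f p w) z := by
  rw [normalPart.eq_def I J f p z, inner_sub_right, inner_normalPart I J hf, sub_zero]

/-- Along an isometric immersion, half of the Lie derivative of the metric along the tangential
part of a concurrent vector field is `g + g'(v^⊥, h)`. -/
theorem half_lieDerivMetric_tangentialPart {v : Π x : N, TangentSpace J x}
    (hv : IsConcurrent J v) {f : M → N} (hf : IsIsometricImmersion I J f) {p : M}
    (hV : MDiffAt (T% (fun q : M ↦ tangentialPart I J f q (v (f q)))) p)
    (w : TangentSpace I p) :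
    1 / 2 * lieDerivMetric I (fun q : M ↦ tangentialPart I J f q (v (f q)))
        (FiberBundle.extend E w) (FiberBundle.extend E w) p =
      inner ℝ w w + inner ℝ (normalPart I J f p (v (f p)))
        (secondFundamentalForm I J f p w w) := by
  set V : Π q : M, TangentSpace I q := fun q ↦ tangentialPart I J f q (v (f q)) with hVdef
  set X : Π q : M, TangentSpace I q := FiberBundle.extend E w with hXdef
  have hX : MDiffAt (T% X) p :=
    FiberBundle.mdifferentiableAt_extend I E (V := fun x : M ↦ TangentSpace I x) w
  have hXp : X p = w := FiberBundle.extend_apply_self E w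
  have hfd : MDiffAt f p := hf.smooth.mdifferentiable (by simp) p
  have hvd : MDiffAt (T% v) (f p) := hv.smooth.mdifferentiable (by simp) (f p)
  have hdX := mdifferentiableAt_mfderiv_apply (J := J) hf.smooth hX
  have hdV := mdifferentiableAt_mfderiv_apply (J := J) hf.smooth hV
  have hXX : (fun q ↦ (inner ℝ (X q) (X q) : ℝ)) =
      fun q ↦ inner ℝ (mfderiv I J f q (X q)) (mfderiv I J f q (X q)) :=
    funext fun q ↦ (hf.isometric q _ _).symm
  have hVX : (fun q ↦ (inner ℝ (mfderiv I J f q (V q)) (mfderiv I J f q (X q)) : ℝ)) =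
      fun q ↦ inner ℝ (v (f q)) (mfderiv I J f q (X q)) :=
    funext fun q ↦ (hf.isometric q _ _).trans (inner_tangentialPart f q _ _)
  have h1 := mvfderiv_inner_along hfd hdX hdX (V p)
  have h2 := mvfderiv_inner_along hfd hdV hdX (X p)
  have h3 := mvfderiv_inner_along hfd (W := fun q ↦ v (f q)) (hvd.comp p hfd) hdX (X p)
  rw [hVX, h3, covAlong_comp hfd hvd, hv.concurrent, hf.isometric] at h2
  have h4 := covAlong_mfderiv_sub (J := J) hf.smooth hV hX
  have h5 : inner ℝ (VectorField.mlieBracket I V X p) (X p) =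
      inner ℝ (covAlong I J f (fun q ↦ mfderiv I J f q (X q)) p (V p)) (mfderiv I J f p (X p))
        - inner ℝ (covAlong I J f (fun q ↦ mfderiv I J f q (V q)) p (X p))
          (mfderiv I J f p (X p)) := by
    rw [← inner_sub_left, h4, hf.isometric]
  have h6 : inner ℝ (normalPart I J f p (v (f p))) (secondFundamentalForm I J f p w w) =
      inner ℝ (v (f p)) (covAlong I J f (fun q ↦ mfderiv I J f q (X q)) p (X p))
        - inner ℝ (mfderiv I J f p (V p))
          (covAlong I J f (fun q ↦ mfderiv I J f q (X q)) p (X p)) := by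
    rw [secondFundamentalForm, inner_normalPart_normalPart hf, normalPart, inner_sub_left, hXp]
  rw [lieDerivMetric, hXX, h1, real_inner_comm _ (X p), h5, h6, ← hXp,
    real_inner_comm (mfderiv I J f p (X p))]
  linarith

end Soliton

end YamabeSoliton

end

theorem proposition4p3
    {E : Type*} [NormedAddCommGroup E] [NormedSpace ℝ E] [FiniteDimensional ℝ E] [Nontrivial E]
    {H : Type*} [TopologicalSpace H] (I : ModelWithCorners ℝ E H) [I.Boundaryless]
    {M : Type*} [TopologicalSpace M] [ChartedSpace H M] [IsManifold I ∞ M]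
    [RiemannianBundle (fun x : M ↦ TangentSpace I x)]
    [IsContMDiffRiemannianBundle I ∞ E (fun x : M ↦ TangentSpace I x)]
    {F : Type*} [NormedAddCommGroup F] [NormedSpace ℝ F] [FiniteDimensional ℝ F]
    {G : Type*} [TopologicalSpace G] (J : ModelWithCorners ℝ F G) [J.Boundaryless]
    {N : Type*} [TopologicalSpace N] [ChartedSpace G N] [IsManifold J ∞ N]
    [RiemannianBundle (fun x : N ↦ TangentSpace J x)]
    [IsContMDiffRiemannianBundle J ∞ F (fun x : N ↦ TangentSpace J x)]
    (v : Π x : N, TangentSpace J x) (hv : YamabeSoliton.IsConcurrent J v)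
    (f : M → N) (hf : YamabeSoliton.IsIsometricImmersion I J f)
    (hmin : YamabeSoliton.IsMinimal I J f)
    (ρ : M → ℝ)
    (hsol : YamabeSoliton.IsAlmostYamabeSoliton I
      (fun p : M ↦ YamabeSoliton.tangentialPart I J f p (v (f p))) ρ) :
    ∀ p : M, YamabeSoliton.scalarCurvature I p = ρ p + 1 := by
  intro p
  have hn : (0 : ℝ) < Module.finrank ℝ E := by exact_mod_cast Module.finrank_pos
  set e := stdOrthonormalBasis ℝ (TangentSpace I p)
  have htrace : ∑ i, YamabeSoliton.secondFundamentalForm I J f p (e i) (e i) = 0 :=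
    (smul_eq_zero.1 (hmin p)).resolve_left (inv_ne_zero hn.ne')
  have hsum : ∑ i, inner ℝ (YamabeSoliton.normalPart I J f p (v (f p)))
      (YamabeSoliton.secondFundamentalForm I J f p (e i) (e i)) = 0 := by
    rw [← inner_sum, htrace, inner_zero_right]
  have key : ∀ i, YamabeSoliton.scalarCurvature I p - ρ p =
      1 + inner ℝ (YamabeSoliton.normalPart I J f p (v (f p)))
        (YamabeSoliton.secondFundamentalForm I J f p (e i) (e i)) := by
    intro i
    have hs := FiberBundle.contMDiffAt_extend (k := ∞) I E
      (V := fun x : M ↦ TangentSpace I x) (e i)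
    have h := hsol.soliton p _ _ hs hs
    have he : inner ℝ (e i) (e i) = (1 : ℝ) := by
      rw [real_inner_self_eq_norm_sq, e.norm_eq_one, one_pow]
    rwa [YamabeSoliton.half_lieDerivMetric_tangentialPart hv hf
      (hsol.smooth_field.mdifferentiable (by simp) p), FiberBundle.extend_apply_self, he,
      mul_one] at h
  have h := Finset.sum_congr rfl fun i (_ : i ∈ Finset.univ) ↦ key i
  rw [Finset.sum_add_distrib, hsum, add_zero, Finset.sum_const, Finset.sum_const, Finset.card_univ,
    Fintype.card_fin, nsmul_eq_mul, nsmul_eq_mul] at h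
  have h' := mul_left_cancel₀ hn.ne' h
  linarith
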